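/- Let $\mathcal H$ be a separable complex Hilbert space. For an integer $p\ge 1$ let $\mathcal J_p(\mathcal H)$ be the Schatten--von Neumann class of compact operators $K$ on $\mathcal H$ with $\operatorname{tr}(|K|^p)<\infty$, where $|K|=(K^*K)^{1/2}$. For $K\in\mathcal J_p(\mathcal H)$ and $z\in\mathbb C$ the $p$-modified Fredholm determinant is $$\det\nolimits_p(I+zK)=\prod_{n}\Bigl[(1+z\lambda_n)\exp\Bigl(\sum_{j=1}^{p-1}\frac{z^j(-\lambda_n)^j}{j}\Bigr)\Bigr],$$ where $(\lambda_n)$ are the nonzero eigenvalues of $K$, repeated according to algebraic multiplicity; $\det_p(I-zK)$ is this expression with $-z$ in place of $z$, and $\det_p(I-z^2K^2)$ is the same expression for the operator $K^2$ with $-z^2$ in place of $z$. (a) If $K\in\mathcal J_2(\mathcal H)$, then $K^2\in\mathcal J_1(\mathcal H)$ and, for every $z\in\mathbb C$, the products defining the following determinants converge unconditionally and $$\det\nolimits_1(I-z^2K^2)=\det\nolimits_2(I-zK)\,\det\nolimits_2(I+zK).$$ Moreover, for every $z\in\mathbb C$ with $\det_2(I-zK)=\det_2(I+zK)$, $$\bigl(\det\nolimits_2(I-zK)\bigr)^2=\det\nolimits_1(I-z^2K^2).$$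 (b) If $K\in\mathcal J_3(\mathcal H)$, then $K^2\in\mathcal J_2(\mathcal H)$ and, for every $z\in\mathbb C$, the products defining the following determinants converge unconditionally and $$\det\nolimits_2(I-z^2K^2)=\det\nolimits_3(I-zK)\,\det\nolimits_3(I+zK).$$ -/

import Mathlib

open scoped ENNReal InnerProductSpace

namespace FredholmDet

variable {H : Type*} [NormedAddCommGroup H] [InnerProductSpace ℂ H]

/-- The sum `∑ ⟪bᵢ, A bᵢ⟫ ∈ [0, ∞]` of the diagonal entries of `A` (meant for `A ≥ 0`) in an
orthonormal basis `b`. -/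
noncomputable def diagSum {ι : Type*} (b : HilbertBasis ι ℂ H) (A : H →L[ℂ] H) : ℝ≥0∞ :=
  ∑' i, ENNReal.ofReal (RCLike.re ⟪b i, A (b i)⟫_ℂ)

theorem ofReal_norm_sq_eq_tsum {ι : Type*} (b : HilbertBasis ι ℂ H) (x : H) :
    ENNReal.ofReal (‖x‖ ^ 2) = ∑' i, ENNReal.ofReal (‖⟪b i, x⟫_ℂ‖ ^ 2) := by
  have h := Complex.hasSum_re (b.hasSum_inner_mul_inner x x)
  have h1 : (⟪x, x⟫_ℂ).re = ‖x‖ ^ 2 := inner_self_eq_norm_sq (𝕜 := ℂ) x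
  have h2 : HasSum (fun i => ‖⟪b i, x⟫_ℂ‖ ^ 2) (‖x‖ ^ 2) := by
    rw [h1] at h
    refine h.congr_fun fun i => ?_
    rw [← inner_conj_symm x (b i), RCLike.conj_mul]
    norm_cast
  rw [← h2.tsum_eq, ENNReal.ofReal_tsum_of_nonneg (fun _ => by positivity) h2.summable]

variable [CompleteSpace H]

/-- The trace in `[0, ∞]` of a positive operator, computed in some orthonormal basis of `H`;
by `posTrace_eq_diagSum` every orthonormal basis gives the same value. -/
noncomputable def posTrace (A : H →L[ℂ] H) : ℝ≥0∞ :=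
  diagSum (exists_hilbertBasis ℂ H).choose_spec.choose A

theorem diagSum_eq_diagSum {ι κ : Type*} (b : HilbertBasis ι ℂ H) (c : HilbertBasis κ ℂ H)
    {A : H →L[ℂ] H} (hA : 0 ≤ A) : diagSum b A = diagSum c A := by
  set S := CFC.sqrt A with hS
  have hSS : S * S = A := CFC.sqrt_mul_sqrt_self A hA
  have hsa : IsSelfAdjoint S := IsSelfAdjoint.of_nonneg (CFC.sqrt_nonneg A)
  have hsym : ∀ x y : H, ⟪S x, y⟫_ℂ = ⟪x, S y⟫_ℂ := fun x y =>
    (ContinuousLinearMap.isSelfAdjoint_iff_isSymmetric.mp hsa) x y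
  have key : ∀ x : H, RCLike.re ⟪x, A x⟫_ℂ = ‖S x‖ ^ 2 := fun x => by
    rw [← hSS, mul_apply_eq_comp, ← hsym, inner_self_eq_norm_sq]
  unfold diagSum
  simp_rw [key]
  calc ∑' i, ENNReal.ofReal (‖S (b i)‖ ^ 2)
      = ∑' i, ∑' j, ENNReal.ofReal (‖⟪c j, S (b i)⟫_ℂ‖ ^ 2) := by
        simp_rw [← ofReal_norm_sq_eq_tsum c]
    _ = ∑' j, ∑' i, ENNReal.ofReal (‖⟪c j, S (b i)⟫_ℂ‖ ^ 2) := ENNReal.tsum_comm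
    _ = ∑' j, ∑' i, ENNReal.ofReal (‖⟪b i, S (c j)⟫_ℂ‖ ^ 2) := by
        exact tsum_congr fun j => tsum_congr fun i => by rw [← hsym, norm_inner_symm]
    _ = ∑' j, ENNReal.ofReal (‖S (c j)‖ ^ 2) := by
        simp_rw [← ofReal_norm_sq_eq_tsum b]

theorem posTrace_eq_diagSum {ι : Type*} (b : HilbertBasis ι ℂ H) {A : H →L[ℂ] H} (hA : 0 ≤ A) :
    posTrace A = diagSum b A :=
  diagSum_eq_diagSum _ b hA

variable (H) in
/-- The Schatten–von Neumann class `𝒥_p(H)`, for an integer `p ≥ 1`: the compact operators `K`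
on `H` with `tr(|K|^p) < ∞`, where `|K| = (K* K)^{1/2}`. -/
def schattenClass (p : ℕ) : Set (H →L[ℂ] H) :=
  {K | IsCompactOperator K ∧ posTrace (CFC.abs K ^ p) < ∞}

/-- The algebraic multiplicity of `μ` as an eigenvalue of `K`: the dimension of the generalized
eigenspace `⋃ₙ ker (K - μ)ⁿ`. It is `0` if `μ` is not an eigenvalue, and for compact `K` the
generalized eigenspace is finite-dimensional for every `μ ≠ 0`. -/
noncomputable def algMult (K : H →L[ℂ] H) (μ : ℂ) : ℕ :=
  Module.finrank ℂ (Module.End.maxGenEigenspace (K : Module.End ℂ H) μ)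

/-- The contribution of `μ` to `det_p(I + z K)`: the factor
`(1 + z μ) exp (∑_{j=1}^{p-1} z^j (-μ)^j / j)`, as many times as the algebraic multiplicity
of `μ`. It is `1` for `μ = 0` and for every `μ` that is not an eigenvalue of `K`. -/
noncomputable def detFactor (p : ℕ) (K : H →L[ℂ] H) (z μ : ℂ) : ℂ :=
  ((1 + z * μ) * Complex.exp (∑ j ∈ Finset.Ico 1 p, z ^ j * (-μ) ^ j / (j : ℂ))) ^ algMult K μ

/-- The infinite product over the eigenvalues of `K`, repeated according to algebraic
multiplicity, that defines `det_p(I + z K)` converges (unconditionally). -/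
def DetConverges (p : ℕ) (K : H →L[ℂ] H) (z : ℂ) : Prop :=
  Multipliable (detFactor p K z)

/-- The `p`-modified Fredholm determinant `det_p(I + z K)`, that is, the infinite product
`∏ₙ (1 + z λₙ) exp (∑_{j=1}^{p-1} z^j (-λₙ)^j / j)` over the eigenvalues `λₙ` of `K`, repeated
according to algebraic multiplicity. -/
noncomputable def modDet (p : ℕ) (K : H →L[ℂ] H) (z : ℂ) : ℂ :=
  ∏' μ : ℂ, detFactor p K z μ

end FredholmDet

namespace FredholmDet

open Filter Module.End

/-! ### Convergence of the products and the factorization by squaring eigenvalues. -/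

section Products

variable {H : Type*} [NormedAddCommGroup H] [InnerProductSpace ℂ H]

/-! The identity is a regrouping of eigenvalues. The factors of `det_p(I - zK)` and `det_p(I + zK)`
at `μ` multiply to the factor of `K²` at `μ²`: odd terms in the exponents cancel and even ones
double. The multiplicity of `μ² ≠ 0` for `K²` is the sum of those of `±μ` for `K` (`algMult_sq`), so
collecting the product over the fibres of squaring gives the claim (`hasProd_detFactor_sq`).

Convergence needs `∑ m(μ)|μ|^p < ∞`, where `m` is the algebraic multiplicity. As in Schur's
triangularization, an orthonormal set is built in which `K` has the eigenvalues on its diagonal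
(`exists_orthonormal_of_finset`). The `p`-th powers of these entries sum to at most `tr |K|^p`
(`sum_norm_inner_pow_le`). The same bound makes the generalized eigenspaces for nonzero eigenvalues
finite-dimensional.

That `K²` lies in the smaller class is shown with singular vectors and elementary inequalities. -/

theorem one_add_mul_exp_eq_exp_log_sub_logTaylor (p : ℕ) (z μ : ℂ) (h : ‖z * μ‖ < 1) :
    (1 + z * μ) * Complex.exp (∑ j ∈ Finset.Ico 1 p, z ^ j * (-μ) ^ j / (j : ℂ)) =
      Complex.exp (Complex.log (1 + z * μ) - Complex.logTaylor p (z * μ)) := by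
  have hne : 1 + z * μ ≠ 0 := fun h0 => by
    have : z * μ = -1 := by linear_combination h0
    simp [this] at h
  have hs : Complex.logTaylor p (z * μ) =
      -∑ j ∈ Finset.Ico 1 p, z ^ j * (-μ) ^ j / (j : ℂ) := by
    rcases Nat.eq_zero_or_pos p with rfl | hp
    · simp [Complex.logTaylor]
    rw [Complex.logTaylor, Finset.range_eq_Ico, Finset.sum_eq_sum_Ico_succ_bot hp,
      ← Finset.sum_neg_distrib]
    simp only [Nat.cast_zero, div_zero, zero_add]
    refine Finset.sum_congr rfl fun j _ => ?_
    rw [neg_pow μ, mul_pow]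
    ring
  rw [Complex.exp_sub, Complex.exp_log hne, hs, Complex.exp_neg, div_inv_eq_mul]

/-- The constant 4 is 2 · 2: the logarithm's Taylor remainder is at most `2|zμ|^p` when `|zμ| ≤
1/2`, and `|exp v - 1| ≤ 2|v|` when `|v| ≤ 1`. The bound `(1/2)^p` secures both conditions. -/
theorem norm_detFactor_sub_one_le {p : ℕ} (hp : 1 ≤ p) (K : H →L[ℂ] H) (z μ : ℂ)
    (h : ‖z‖ ^ p * (algMult K μ * ‖μ‖ ^ p) ≤ (1 / 2) ^ p) :
    ‖detFactor p K z μ - 1‖ ≤ 4 * (‖z‖ ^ p * (algMult K μ * ‖μ‖ ^ p)) := by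
  set m := algMult K μ with hm
  rcases Nat.eq_zero_or_pos m with h0 | hpos
  · simp [detFactor, ← hm, h0]
  have hm1 : (1 : ℝ) ≤ m := by exact_mod_cast hpos
  have hw : ‖z * μ‖ ^ p ≤ (1 / 2) ^ p := by
    refine le_trans ?_ h
    rw [norm_mul, mul_pow]
    have h1 : 0 ≤ ‖μ‖ ^ p := by positivity
    gcongr
    nlinarith
  have hw2 : ‖z * μ‖ ≤ 1 / 2 := le_of_pow_le_pow_left₀ (by omega) (by norm_num) hw
  obtain ⟨q, rfl⟩ : ∃ q, p = q + 1 := ⟨p - 1, by omega⟩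
  have hlog := Complex.norm_log_sub_logTaylor_le q (z := z * μ) (by linarith)
  set u := Complex.log (1 + z * μ) - Complex.logTaylor (q + 1) (z * μ) with hu
  have hu2 : ‖u‖ ≤ 2 * ‖z * μ‖ ^ (q + 1) := by
    refine hlog.trans ((div_le_self (by
      have : 0 ≤ (1 - ‖z * μ‖)⁻¹ := inv_nonneg.2 (by linarith)
      positivity) (by linarith [(Nat.cast_nonneg q : (0 : ℝ) ≤ q)])).trans ?_)
    have : (1 - ‖z * μ‖)⁻¹ ≤ 2 := by
      rw [inv_le_comm₀ (by linarith) (by norm_num)]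
      linarith
    rw [mul_comm]
    gcongr
  have hmu : ‖(m : ℂ) * u‖ ≤ 2 * (‖z‖ ^ (q + 1) * (m * ‖μ‖ ^ (q + 1))) := by
    rw [norm_mul, Complex.norm_natCast]
    calc (m : ℝ) * ‖u‖ ≤ m * (2 * ‖z * μ‖ ^ (q + 1)) := by gcongr
      _ = _ := by rw [norm_mul, mul_pow]; ring
  have hhalf : ((1 : ℝ) / 2) ^ (q + 1) ≤ 1 / 2 :=
    pow_le_of_le_one (by norm_num) (by norm_num) (by omega)
  rw [detFactor, one_add_mul_exp_eq_exp_log_sub_logTaylor _ _ _ (by linarith), ← hu,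
    ← Complex.exp_nat_mul]
  refine (Complex.norm_exp_sub_one_le (by linarith)).trans (by linarith)

theorem detConverges_of_summable {p : ℕ} (hp : 1 ≤ p) {K : H →L[ℂ] H}
    (h : Summable fun μ : ℂ => (algMult K μ : ℝ) * ‖μ‖ ^ p) (z : ℂ) : DetConverges p K z := by
  have h1 := h.mul_left (‖z‖ ^ p)
  have h2 : Summable fun μ => detFactor p K z μ - 1 := by
    refine Summable.of_norm_bounded_eventually (h1.mul_left 4) ?_
    filter_upwards [h1.tendsto_cofinite_zero.eventually_le_const
      (show (0 : ℝ) < (1 / 2) ^ p by positivity)] with μ hμ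
    exact norm_detFactor_sub_one_le hp K z μ hμ
  simpa [DetConverges] using Complex.multipliable_one_add_of_summable h2

/-- For `μ ≠ 0` the polynomials `(X - μ)^n` and `(X + μ)^n` are coprime, so the kernel of their
product at `f` splits. -/
theorem maxGenEigenspace_sq (f : Module.End ℂ H) {μ : ℂ} (hμ : μ ≠ 0) :
    maxGenEigenspace (f ^ 2) (μ ^ 2) = maxGenEigenspace f μ ⊔ maxGenEigenspace f (-μ) := by
  have hcop (n : ℕ) : IsCoprime ((Polynomial.X - Polynomial.C μ) ^ n)
      ((Polynomial.X - Polynomial.C (-μ)) ^ n) :=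
    (Polynomial.isCoprime_X_sub_C_of_isUnit_sub
      (IsUnit.mk0 _ (by simpa [← two_mul] using hμ))).pow
  have hX (ν : ℂ) (n : ℕ) : Polynomial.aeval f ((Polynomial.X - Polynomial.C ν) ^ n) =
      (f - ν • (1 : Module.End ℂ H)) ^ n := by
    simp [Algebra.algebraMap_eq_smul_one]
  have hker (n : ℕ) : LinearMap.ker ((f ^ 2 - μ ^ 2 • (1 : Module.End ℂ H)) ^ n) =
      LinearMap.ker ((f - μ • (1 : Module.End ℂ H)) ^ n) ⊔
        LinearMap.ker ((f - (-μ) • (1 : Module.End ℂ H)) ^ n) := by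
    rw [← hX, ← hX, Polynomial.sup_ker_aeval_eq_ker_aeval_mul_of_coprime _ (hcop n), ← mul_pow]
    congr 1
    simp only [map_pow, map_mul, map_sub, Polynomial.aeval_X, Polynomial.aeval_C, map_neg]
    congr 1
    rw [← Algebra.algebraMap_eq_smul_one, map_pow]
    have : Commute f (algebraMap ℂ (Module.End ℂ H) μ) := (Algebra.commutes μ f).symm
    rw [sub_neg_eq_add, mul_add, sub_mul, sub_mul, this.eq, pow_two, pow_two]
    abel
  apply le_antisymm
  · intro x hx
    obtain ⟨n, hn⟩ := (mem_maxGenEigenspace _ _ _).1 hx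
    rw [← LinearMap.mem_ker, hker] at hn
    have hle (ν : ℂ) : LinearMap.ker ((f - ν • (1 : Module.End ℂ H)) ^ n) ≤
        maxGenEigenspace f ν := fun y hy => (mem_maxGenEigenspace _ _ _).2 ⟨n, hy⟩
    exact sup_le_sup (hle μ) (hle (-μ)) hn
  · refine sup_le ?_ ?_ <;> intro x hx <;>
    obtain ⟨n, hn⟩ := (mem_maxGenEigenspace _ _ _).1 hx <;>
    refine (mem_maxGenEigenspace _ _ _).2 ⟨n, ?_⟩ <;>
    rw [← LinearMap.mem_ker, hker]
    · exact Submodule.mem_sup_left hn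
    · exact Submodule.mem_sup_right hn

theorem algMult_sq {K : H →L[ℂ] H} {μ : ℂ} (hμ : μ ≠ 0)
    (hfin : ∀ ν ≠ 0, FiniteDimensional ℂ (maxGenEigenspace (K : Module.End ℂ H) ν)) :
    algMult (K ^ 2) (μ ^ 2) = algMult K μ + algMult K (-μ) := by
  have := hfin μ hμ
  have := hfin (-μ) (neg_ne_zero.2 hμ)
  have hd : Disjoint (maxGenEigenspace (K : Module.End ℂ H) μ)
      (maxGenEigenspace (K : Module.End ℂ H) (-μ)) :=
    disjoint_genEigenspace _ (fun h => hμ (self_eq_neg.1 h)) _ _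
  have hs := Submodule.finrank_sup_add_finrank_inf_eq (maxGenEigenspace (K : Module.End ℂ H) μ)
    (maxGenEigenspace (K : Module.End ℂ H) (-μ))
  rw [hd.eq_bot, finrank_bot, add_zero] at hs
  rw [algMult, algMult, algMult, ← hs, ← maxGenEigenspace_sq _ hμ]
  rfl

/-- The factors of `det_p(I - zK)` and `det_p(I + zK)` at `μ` multiply to a power of the factor
of `det_q(I - z²K²)` at `μ²`, as soon as this holds for multiplicity one. -/
theorem hasProd_detFactor_sq {p q : ℕ} {K : H →L[ℂ] H} {z : ℂ}
    (hfin : ∀ ν ≠ 0, FiniteDimensional ℂ (maxGenEigenspace (K : Module.End ℂ H) ν))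
    (hneg : DetConverges p K (-z)) (hpos : DetConverges p K z) (hpq : ∀ μ : ℂ,
      ((1 + -z * μ) * Complex.exp (∑ j ∈ Finset.Ico 1 p, (-z) ^ j * (-μ) ^ j / (j : ℂ))) *
        ((1 + z * μ) * Complex.exp (∑ j ∈ Finset.Ico 1 p, z ^ j * (-μ) ^ j / (j : ℂ))) =
      (1 + -z ^ 2 * μ ^ 2) *
        Complex.exp (∑ j ∈ Finset.Ico 1 q, (-z ^ 2) ^ j * (-μ ^ 2) ^ j / (j : ℂ))) :
    HasProd (detFactor q (K ^ 2) (-z ^ 2)) (modDet p K (-z) * modDet p K z) := by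
  have hf := hneg.hasProd.mul hpos.hasProd
  change HasProd _ (modDet p K (-z) * modDet p K z) at hf
  set c : ℂ → ℂ := fun ν => (1 + -z ^ 2 * ν) *
    Complex.exp (∑ j ∈ Finset.Ico 1 q, (-z ^ 2) ^ j * (-ν) ^ j / (j : ℂ)) with hc
  have hfc : (fun μ => detFactor p K (-z) μ * detFactor p K z μ) =
      fun μ => c (μ ^ 2) ^ algMult K μ := by
    funext μ
    simp only [detFactor, hc]
    rw [← mul_pow, hpq]
  have hc0 : c 0 = 1 := by
    simp only [hc, mul_zero, add_zero, one_mul, Complex.exp_eq_one_iff]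
    refine ⟨0, ?_⟩
    rw [Int.cast_zero, zero_mul]
    refine Finset.sum_eq_zero fun j hj => ?_
    rw [neg_zero, zero_pow (by have := Finset.mem_Ico.1 hj; omega)]
    simp
  rw [hfc] at hf
  -- The product over `μ` is split along the fibres of `μ ↦ μ²`.
  refine HasProd.sigma ((Equiv.hasProd_iff
    (Equiv.sigmaFiberEquiv fun μ : ℂ => μ ^ 2)).2 hf) fun ν => ?_
  have hval (x : {x : ℂ // x ^ 2 = ν}) : ((fun μ => c (μ ^ 2) ^ algMult K μ) ∘
      (Equiv.sigmaFiberEquiv fun μ : ℂ => μ ^ 2)) ⟨ν, x⟩ = c ν ^ algMult K x := by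
    simp [Equiv.sigmaFiberEquiv, x.2]
  simp_rw [hval]
  change HasProd _ (c ν ^ algMult (K ^ 2) ν)
  by_cases hν : ν = 0
  -- The multiplicity at 0 is irrelevant, since the factor there is 1.
  · simp only [hν, hc0, one_pow]
    exact hasProd_one
  obtain ⟨μ, rfl⟩ := IsAlgClosed.exists_pow_nat_eq ν two_pos
  have hμ : μ ≠ 0 := fun h => hν (by simp [h])
  have hmem (x : ℂ) : x ∈ ({μ, -μ} : Finset ℂ) ↔ x ^ 2 = μ ^ 2 := by
    simp [sq_eq_sq_iff_eq_or_eq_neg]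
  have hprod := Finset.hasProd {μ, -μ} fun x => c (μ ^ 2) ^ algMult K x
  rw [Finset.prod_pair (fun h => hμ (self_eq_neg.1 h)), ← pow_add, ← algMult_sq hμ hfin] at hprod
  exact (Equiv.hasProd_iff (Equiv.subtypeEquivRight hmem)
    (f := fun x : {x : ℂ // x ^ 2 = μ ^ 2} => c (μ ^ 2) ^ algMult K x)).1 hprod

end Products

end FredholmDet

namespace FredholmDet

open Module.End

/-! ### Schur triangularization and summability of eigenvalues. -/

section Schur

variable {H : Type*} [NormedAddCommGroup H] [InnerProductSpace ℂ H]

/-- One Gram–Schmidt step: `e` is the normalized part of `x` orthogonal to the span `W` of `E`. Then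
`K e - μ e` lies in `W`, hence is orthogonal to `e`, so the diagonal entry is `μ`. -/
theorem exists_orthonormal_insert [DecidableEq H] {K : H →L[ℂ] H} {E : Finset H}
    (hE : Orthonormal ℂ ((↑) : E → H))
    (hinv : ∀ y ∈ Submodule.span ℂ (E : Set H), K y ∈ Submodule.span ℂ (E : Set H)) {μ : ℂ} {x : H}
    (hx : x ∉ Submodule.span ℂ (E : Set H)) (hKx : K x - μ • x ∈ Submodule.span ℂ (E : Set H)) :
    ∃ e, e ∉ E ∧ Orthonormal ℂ ((↑) : ↥(insert e E) → H) ∧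
      (∀ y ∈ Submodule.span ℂ ((insert e E : Finset H) : Set H),
        K y ∈ Submodule.span ℂ ((insert e E : Finset H) : Set H)) ∧
      e ∈ Submodule.span ℂ (E : Set H) ⊔ Submodule.span ℂ {x} ∧ ⟪e, K e⟫_ℂ = μ := by
  set W := Submodule.span ℂ (E : Set H) with hW
  have : FiniteDimensional ℂ W := FiniteDimensional.span_finset ℂ E
  set y := x - W.starProjection x with hy
  have hpW : W.starProjection x ∈ W := W.starProjection_apply_mem x
  have hyW : y ∈ Wᗮ := W.sub_starProjection_mem_orthogonal x
  have hy0 : y ≠ 0 := fun h => hx (by rw [sub_eq_zero.1 h]; exact hpW)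
  have hKy : K y - μ • y ∈ W := by
    have : K y - μ • y = (K x - μ • x) - (K (W.starProjection x) - μ • W.starProjection x) := by
      rw [hy, map_sub, smul_sub]; abel
    rw [this]
    exact W.sub_mem hKx (W.sub_mem (hinv _ hpW) (W.smul_mem _ hpW))
  set e : H := ((‖y‖⁻¹ : ℝ) : ℂ) • y with he
  have hen : ‖e‖ = 1 := by
    rw [he, norm_smul, Complex.norm_real, norm_inv, norm_norm,
      inv_mul_cancel₀ (norm_ne_zero_iff.2 hy0)]
  have heW : e ∈ Wᗮ := Wᗮ.smul_mem _ hyW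
  have hKe : K e - μ • e ∈ W := by
    have : K e - μ • e = ((‖y‖⁻¹ : ℝ) : ℂ) • (K y - μ • y) := by
      rw [he, map_smul, smul_sub (_ : ℂ) (K y), smul_comm μ]
    rw [this]
    exact W.smul_mem _ hKy
  have hsub : ∀ a ∈ E, a ∈ W := fun a ha => Submodule.subset_span ha
  have hle : W ≤ Submodule.span ℂ ((insert e E : Finset H) : Set H) :=
    Submodule.span_mono (by simp)
  have hemem : e ∈ Submodule.span ℂ ((insert e E : Finset H) : Set H) :=
    Submodule.subset_span (by simp)
  have hKe' : K e ∈ Submodule.span ℂ ((insert e E : Finset H) : Set H) := by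
    rw [← sub_add_cancel (K e) (μ • e)]
    exact Submodule.add_mem _ (hle hKe) (Submodule.smul_mem _ _ hemem)
  refine ⟨e, fun h => ?_, ?_, fun a ha => ?_, ?_, ?_⟩
  · have := (Submodule.mem_orthogonal W e).1 heW e (hsub e h)
    rw [inner_self_eq_zero] at this
    simp [this] at hen
  · have hE' := (orthonormal_subtype_iff_ite (s := (E : Set H))).1 hE
    refine (orthonormal_subtype_iff_ite (s := ((insert e E : Finset H) : Set H))).2 ?_
    have hee : ⟪e, e⟫_ℂ = 1 := by rw [inner_self_eq_norm_sq_to_K, hen]; simp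
    have hne : ∀ a ∈ E, ⟪a, e⟫_ℂ = 0 ∧ ⟪e, a⟫_ℂ = 0 ∧ a ≠ e := fun a ha => by
      have h0 := (Submodule.mem_orthogonal W e).1 heW a (hsub a ha)
      refine ⟨h0, inner_eq_zero_symm.1 h0, fun h => ?_⟩
      rw [h, hee] at h0
      exact one_ne_zero h0
    intro v hv w hw
    rw [Finset.mem_coe, Finset.mem_insert] at hv hw
    rcases hv with rfl | hv <;> rcases hw with rfl | hw
    · rw [hee, if_pos rfl]
    · rw [(hne w hw).2.1, if_neg (hne w hw).2.2.symm]
    · rw [(hne v hv).1, if_neg (hne v hv).2.2]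
    · exact hE' v hv w hw
  · rw [Finset.coe_insert, Submodule.span_insert, Submodule.mem_sup] at ha
    obtain ⟨b, hb, w, hw, rfl⟩ := ha
    obtain ⟨c, rfl⟩ := Submodule.mem_span_singleton.1 hb
    rw [map_add, map_smul]
    exact Submodule.add_mem _ (Submodule.smul_mem _ _ hKe') (hle (hinv w hw))
  · refine Submodule.smul_mem _ _ (Submodule.sub_mem _ ?_ (Submodule.mem_sup_left hpW))
    exact Submodule.mem_sup_right (Submodule.mem_span_singleton_self x)
  · rw [← sub_add_cancel (K e) (μ • e), inner_add_right,
      inner_eq_zero_symm.1 ((Submodule.mem_orthogonal W e).1 heW _ hKe), inner_smul_right,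
      inner_self_eq_norm_sq_to_K, hen]
    simp

theorem finrank_span_of_orthonormal {E : Finset H} (hE : Orthonormal ℂ ((↑) : E → H)) :
    Module.finrank ℂ (Submodule.span ℂ (E : Set H)) = E.card :=
  finrank_span_finset_eq_card hE.linearIndependent

theorem exists_mem_maxGenEigenspace_notMem {f : Module.End ℂ H} {μ : ℂ} {W : Submodule ℂ H}
    (h : ¬ maxGenEigenspace f μ ≤ W) :
    ∃ x ∈ maxGenEigenspace f μ, x ∉ W ∧ f x - μ • x ∈ W := by
  classical
  obtain ⟨x, hx, hxW⟩ := SetLike.not_le_iff_exists.1 h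
  obtain ⟨N, hN⟩ := (mem_maxGenEigenspace _ _ _).1 hx
  have hex : ∃ k, ((f - μ • (1 : Module.End ℂ H)) ^ k) x ∈ W := ⟨N, by rw [hN]; exact W.zero_mem⟩
  obtain ⟨k, hk⟩ : ∃ k, Nat.find hex = k + 1 :=
    Nat.exists_eq_succ_of_ne_zero fun h0 => hxW (by simpa [h0] using Nat.find_spec hex)
  -- The last vector of the chain `(f - μ)^k x` that is still outside `W`.
  refine ⟨((f - μ • (1 : Module.End ℂ H)) ^ k) x, (mem_maxGenEigenspace _ _ _).2 ⟨N, ?_⟩,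
    Nat.find_min hex (by omega), ?_⟩
  · rw [← Module.End.mul_apply, (Commute.refl _).pow_pow N k |>.eq, Module.End.mul_apply, hN,
      map_zero]
  · have := Nat.find_spec hex
    rw [hk, pow_succ', Module.End.mul_apply] at this
    simpa using this

/-- An orthonormal set spanning an invariant subspace that is disjoint from a generalized
eigenspace of dimension at least `n` can be enlarged by `n` vectors from that eigenspace. -/
theorem exists_orthonormal_union {K : H →L[ℂ] H} {μ : ℂ} (p : ℕ) {E₀ : Finset H}
    (hE₀ : Orthonormal ℂ ((↑) : E₀ → H))
    (hinv : ∀ y ∈ Submodule.span ℂ (E₀ : Set H), K y ∈ Submodule.span ℂ (E₀ : Set H))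
    (hd : Disjoint (Submodule.span ℂ (E₀ : Set H)) (maxGenEigenspace (K : Module.End ℂ H) μ))
    (n : ℕ) (hn : FiniteDimensional ℂ (maxGenEigenspace (K : Module.End ℂ H) μ) →
      n ≤ algMult K μ) :
    ∃ E : Finset H, E₀ ⊆ E ∧ E.card = E₀.card + n ∧ Orthonormal ℂ ((↑) : E → H) ∧
      (∀ y ∈ Submodule.span ℂ (E : Set H), K y ∈ Submodule.span ℂ (E : Set H)) ∧
      Submodule.span ℂ (E : Set H) ≤
        Submodule.span ℂ (E₀ : Set H) ⊔ maxGenEigenspace (K : Module.End ℂ H) μ ∧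
      ∑ e ∈ E, ‖⟪e, K e⟫_ℂ‖ ^ p = ∑ e ∈ E₀, ‖⟪e, K e⟫_ℂ‖ ^ p + n * ‖μ‖ ^ p := by
  classical
  induction n with
  | zero => exact ⟨E₀, subset_rfl, rfl, hE₀, hinv, le_sup_left, by simp⟩
  | succ n ih =>
    obtain ⟨E, hsub, hcard, hE, hEinv, hEle, hsum⟩ := ih fun h => (Nat.le_succ n).trans (hn h)
    -- Otherwise the span of `E`, of dimension `|E₀| + n`, would contain the direct sum of the span
    -- of `E₀` and the eigenspace, whose dimension is at least `|E₀| + n + 1`.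
    have hnot : ¬ maxGenEigenspace (K : Module.End ℂ H) μ ≤ Submodule.span ℂ (E : Set H) := by
      intro hle
      have hWfin : FiniteDimensional ℂ (Submodule.span ℂ (E : Set H)) :=
        FiniteDimensional.span_finset ℂ E
      have hW₀fin : FiniteDimensional ℂ (Submodule.span ℂ (E₀ : Set H)) :=
        FiniteDimensional.span_finset ℂ E₀
      have hGfin := Submodule.finiteDimensional_of_le hle
      have h1 := hn hGfin
      have h2 := Submodule.finrank_sup_add_finrank_inf_eq (Submodule.span ℂ (E₀ : Set H))
        (maxGenEigenspace (K : Module.End ℂ H) μ)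
      have h3 := Submodule.finrank_mono (sup_le (Submodule.span_mono (Finset.coe_subset.2 hsub)) hle)
      rw [hd.eq_bot, finrank_bot, finrank_span_of_orthonormal hE₀] at h2
      rw [finrank_span_of_orthonormal hE] at h3
      unfold algMult at h1
      omega
    obtain ⟨x, hxG, hxE, hKx⟩ := exists_mem_maxGenEigenspace_notMem hnot
    obtain ⟨e, heE, hoe, hinve, hmem, hee⟩ := exists_orthonormal_insert hE hEinv hxE hKx
    refine ⟨insert e E, hsub.trans (Finset.subset_insert e E), ?_, hoe, hinve, ?_, ?_⟩
    · rw [Finset.card_insert_of_notMem heE, hcard, add_assoc]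
    · rw [Finset.coe_insert, Submodule.span_insert]
      refine sup_le ((Submodule.span_singleton_le_iff_mem _ _).2 ?_) hEle
      exact sup_le hEle ((Submodule.span_singleton_le_iff_mem _ _).2
        (Submodule.mem_sup_right hxG)) hmem
    · rw [Finset.sum_insert heE, hsum, hee]
      push_cast
      ring

/-- The count `n μ` is unrestricted on an infinite-dimensional eigenspace, where `algMult` is 0 by
the convention for `finrank`. This is what lets a trace bound rule out that case. -/
theorem exists_orthonormal_of_finset {K : H →L[ℂ] H} (p : ℕ) (n : ℂ → ℕ) (s : Finset ℂ)
    (hn : ∀ μ ∈ s, FiniteDimensional ℂ (maxGenEigenspace (K : Module.End ℂ H) μ) →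
      n μ ≤ algMult K μ) :
    ∃ E : Finset H, Orthonormal ℂ ((↑) : E → H) ∧
      (∀ y ∈ Submodule.span ℂ (E : Set H), K y ∈ Submodule.span ℂ (E : Set H)) ∧
      Submodule.span ℂ (E : Set H) ≤ ⨆ μ ∈ s, maxGenEigenspace (K : Module.End ℂ H) μ ∧
      ∑ e ∈ E, ‖⟪e, K e⟫_ℂ‖ ^ p = ∑ μ ∈ s, n μ * ‖μ‖ ^ p := by
  classical
  induction s using Finset.induction_on with
  | empty =>
    refine ⟨∅, ⟨fun x => absurd x.2 (Finset.notMem_empty _),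
      fun x => absurd x.2 (Finset.notMem_empty _)⟩, ?_, by simp, by simp⟩
    intro y hy
    simp only [Finset.coe_empty, Submodule.span_empty, Submodule.mem_bot] at hy ⊢
    rw [hy, map_zero]
  | insert μ s hμ ih =>
    obtain ⟨E₀, hE₀, hinv₀, hle₀, hsum₀⟩ := ih fun ν hν => hn ν (Finset.mem_insert_of_mem hν)
    have hd := (independent_maxGenEigenspace (K : Module.End ℂ H)).disjoint_biSup
      (x := μ) (y := (s : Set ℂ)) (by simpa using hμ)
    obtain ⟨E, -, -, hE, hinv, hle, hsum⟩ := exists_orthonormal_union p hE₀ hinv₀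
      (hd.symm.mono_left (by simpa using hle₀)) (n μ) (hn μ (Finset.mem_insert_self μ s))
    refine ⟨E, hE, hinv, hle.trans ?_, ?_⟩
    · rw [Finset.iSup_insert, sup_comm]
      exact sup_le_sup_left hle₀ _
    · rw [hsum, hsum₀, Finset.sum_insert hμ, add_comm]

section Bound

variable {K : H →L[ℂ] H} {p : ℕ} {C : ℝ}

theorem finiteDimensional_maxGenEigenspace_of_forall_orthonormal
    (hC : ∀ E : Finset H, Orthonormal ℂ ((↑) : E → H) → ∑ e ∈ E, ‖⟪e, K e⟫_ℂ‖ ^ p ≤ C)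
    {μ : ℂ} (hμ : μ ≠ 0) :
    FiniteDimensional ℂ (maxGenEigenspace (K : Module.End ℂ H) μ) := by
  by_contra hinf
  obtain ⟨n, hn⟩ := exists_nat_gt (C / ‖μ‖ ^ p)
  obtain ⟨E, hE, -, -, hsum⟩ := exists_orthonormal_of_finset (K := K) p (fun _ => n) {μ}
    fun ν hν h => by rw [Finset.mem_singleton.1 hν] at h; exact absurd h hinf
  have h1 := hC E hE
  rw [hsum, Finset.sum_singleton] at h1
  rw [div_lt_iff₀ (by positivity)] at hn
  linarith

theorem summable_algMult_mul_of_forall_orthonormal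
    (hC : ∀ E : Finset H, Orthonormal ℂ ((↑) : E → H) → ∑ e ∈ E, ‖⟪e, K e⟫_ℂ‖ ^ p ≤ C) :
    Summable fun μ : ℂ => (algMult K μ : ℝ) * ‖μ‖ ^ p := by
  refine summable_of_sum_le (fun μ => by positivity) (c := C) fun s => ?_
  obtain ⟨E, hE, -, -, hsum⟩ := exists_orthonormal_of_finset (K := K) p (algMult K) s
    fun ν _ _ => le_rfl
  rw [← hsum]
  exact hC E hE

end Bound

end Schur

end FredholmDet

namespace FredholmDet

open Module.End

/-! ### Trace inequalities, singular vectors and squares of Schatten operators. -/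

section Schatten

universe u

variable {H : Type*} [NormedAddCommGroup H] [InnerProductSpace ℂ H] [CompleteSpace H]

theorem tsum_ofReal_inner_le_posTrace {ι : Type*} {v : ι → H} (hv : Orthonormal ℂ v)
    {B : H →L[ℂ] H} (hB : 0 ≤ B) :
    ∑' i, ENNReal.ofReal (RCLike.re ⟪v i, B (v i)⟫_ℂ) ≤ posTrace B := by
  obtain ⟨w, b, hw, hb⟩ := hv.toSubtypeRange.exists_hilbertBasis_extension
  rw [posTrace_eq_diagSum b hB, diagSum]
  have hinj : Function.Injective fun i => (⟨v i, hw ⟨i, rfl⟩⟩ : w) := fun i j h =>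
    hv.linearIndependent.injective (Subtype.ext_iff.1 h)
  refine le_trans (le_of_eq (tsum_congr fun i => ?_))
    (ENNReal.tsum_comp_le_tsum_of_injective hinj _)
  simp [hb]

theorem re_inner_star_mul_self (K : H →L[ℂ] H) (x : H) :
    RCLike.re ⟪x, (star K * K) x⟫_ℂ = ‖K x‖ ^ 2 := by
  rw [ContinuousLinearMap.star_eq_adjoint, mul_apply_eq_comp,
    ContinuousLinearMap.adjoint_inner_right, inner_self_eq_norm_sq]

theorem abs_pow_two (K : H →L[ℂ] H) : CFC.abs K ^ 2 = star K * K := by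
  rw [pow_two, CFC.abs_mul_abs]

theorem inner_abs_left (K : H →L[ℂ] H) (x y : H) :
    ⟪CFC.abs K x, y⟫_ℂ = ⟪x, CFC.abs K y⟫_ℂ :=
  ContinuousLinearMap.isSelfAdjoint_iff_isSymmetric.1
    (IsSelfAdjoint.of_nonneg (CFC.abs_nonneg K)) x y

theorem inner_apply_apply (K : H →L[ℂ] H) (x y : H) :
    ⟪K x, K y⟫_ℂ = ⟪CFC.abs K x, CFC.abs K y⟫_ℂ := by
  rw [inner_abs_left, ← mul_apply_eq_comp, CFC.abs_mul_abs,
    ContinuousLinearMap.star_eq_adjoint, mul_apply_eq_comp,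
    ContinuousLinearMap.adjoint_inner_right]

theorem norm_abs_apply (K : H →L[ℂ] H) (x : H) : ‖CFC.abs K x‖ = ‖K x‖ := by
  rw [@norm_eq_sqrt_re_inner ℂ _ _ _ _ (K x), inner_apply_apply, ← norm_eq_sqrt_re_inner]

theorem re_inner_abs_pow_two (K : H →L[ℂ] H) (x : H) :
    RCLike.re ⟪x, (CFC.abs K ^ 2) x⟫_ℂ = ‖K x‖ ^ 2 := by
  rw [abs_pow_two, re_inner_star_mul_self]

/-- With `A = |K|` and `S = A^{1/2}`, Cauchy–Schwarz gives `‖Sx‖² ≤ ‖Ax‖` and `‖Ax‖² ≤ ‖Sx‖ ‖SAx‖`.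
Squaring the second and dividing by `‖Ax‖` yields the claim. -/
theorem norm_apply_pow_three_le (K : H →L[ℂ] H) {x : H} (hx : ‖x‖ = 1) :
    ‖K x‖ ^ 3 ≤ RCLike.re ⟪x, (CFC.abs K ^ 3) x⟫_ℂ := by
  set A := CFC.abs K with hA
  set S := CFC.sqrt A with hS
  have hA0 : 0 ≤ A := CFC.abs_nonneg K
  have hSS (y : H) : S (S y) = A y := by
    rw [← mul_apply_eq_comp, CFC.sqrt_mul_sqrt_self A hA0]
  have hsym (y z : H) : ⟪S y, z⟫_ℂ = ⟪y, S z⟫_ℂ :=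
    ContinuousLinearMap.isSelfAdjoint_iff_isSymmetric.1
      (IsSelfAdjoint.of_nonneg (CFC.sqrt_nonneg A)) y z
  have h3 : RCLike.re ⟪x, (A ^ 3) x⟫_ℂ = ‖S (A x)‖ ^ 2 := by
    rw [← inner_self_eq_norm_sq (𝕜 := ℂ), hsym, hSS, hA, inner_abs_left, ← hA]
    rfl
  have h1 : ‖S x‖ ^ 2 ≤ ‖A x‖ := by
    rw [← inner_self_eq_norm_sq (𝕜 := ℂ), hsym, hSS]
    simpa [hx] using re_inner_le_norm (𝕜 := ℂ) x (A x)
  have h2 : ‖A x‖ ^ 2 ≤ ‖S x‖ * ‖S (A x)‖ := by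
    rw [← inner_self_eq_norm_sq (𝕜 := ℂ)]
    nth_rw 1 [← hSS x]
    rw [hsym]
    exact re_inner_le_norm (𝕜 := ℂ) _ _
  rw [h3, ← norm_abs_apply, ← hA]
  rcases (norm_nonneg (A x)).eq_or_lt with h0 | h0
  · rw [← h0, zero_pow three_ne_zero]
    exact sq_nonneg _
  · have h4 : (‖A x‖ ^ 2) ^ 2 ≤ (‖S x‖ * ‖S (A x)‖) ^ 2 := pow_le_pow_left₀ (by positivity) h2 2
    have h5 : ‖S x‖ ^ 2 * ‖S (A x)‖ ^ 2 ≤ ‖A x‖ * ‖S (A x)‖ ^ 2 := by gcongr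
    refine le_of_mul_le_mul_left ?_ h0
    calc ‖A x‖ * ‖A x‖ ^ 3 = (‖A x‖ ^ 2) ^ 2 := by ring
      _ ≤ (‖S x‖ * ‖S (A x)‖) ^ 2 := h4
      _ = ‖S x‖ ^ 2 * ‖S (A x)‖ ^ 2 := by ring
      _ ≤ _ := h5

/-- If `‖K x‖ ^ p` is dominated by the diagonal of `|K| ^ p` on unit vectors, then the diagonal
entries of `K` in orthonormal sets have `p`-th powers summing to at most `tr |K| ^ p`. -/
theorem sum_norm_inner_pow_le {K : H →L[ℂ] H} {p : ℕ}
    (hp : ∀ x : H, ‖x‖ = 1 → ‖K x‖ ^ p ≤ RCLike.re ⟪x, (CFC.abs K ^ p) x⟫_ℂ)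
    (hK : posTrace (CFC.abs K ^ p) < ∞) (E : Finset H) (hE : Orthonormal ℂ ((↑) : E → H)) :
    ∑ e ∈ E, ‖⟪e, K e⟫_ℂ‖ ^ p ≤ (posTrace (CFC.abs K ^ p)).toReal := by
  rw [← ENNReal.ofReal_le_iff_le_toReal hK.ne, ENNReal.ofReal_sum_of_nonneg fun _ _ => by positivity]
  refine le_trans ?_ (tsum_ofReal_inner_le_posTrace hE (CStarAlgebra.pow_nonneg (CFC.abs_nonneg K) p))
  rw [tsum_fintype, ← Finset.sum_coe_sort E]
  refine Finset.sum_le_sum fun e _ => ENNReal.ofReal_le_ofReal ?_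
  have he : ‖(e : H)‖ = 1 := hE.1 e
  refine le_trans ?_ (hp e he)
  gcongr
  simpa [he] using norm_inner_le_norm (𝕜 := ℂ) (e : H) (K e)

theorem exists_hilbertBasis_eigenvectors {H : Type u} [NormedAddCommGroup H]
    [InnerProductSpace ℂ H] [CompleteSpace H] {T : H →L[ℂ] H} (hT : IsCompactOperator T)
    (hsym : (T : H →ₗ[ℂ] H).IsSymmetric) :
    ∃ (ι : Type u) (b : HilbertBasis ι ℂ H) (t : ι → ℂ), ∀ i, T (b i) = t i • b i := by
  have hcl (μ : ℂ) : CompleteSpace (eigenspace (T : Module.End ℂ H) μ) := by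
    refine IsClosed.completeSpace_coe (s := (eigenspace (T : Module.End ℂ H) μ : Set H))
      (hs := ?_)
    have : (eigenspace (T : Module.End ℂ H) μ : Set H) = {x | T x = μ • x} := by
      ext x
      simp
    rw [this]
    exact isClosed_eq T.continuous (continuous_const_smul μ)
  choose w b _ using fun μ : ℂ => exists_hilbertBasis ℂ (eigenspace (T : Module.End ℂ H) μ)
  have horth := hsym.orthogonalFamily_eigenspaces.orthonormal_sigma_orthonormal
    fun μ => (b μ).orthonormal
  have hbot : (Submodule.span ℂ (Set.range fun a : Σ μ, w μ =>
      (eigenspace (T : Module.End ℂ H) a.1).subtypeₗᵢ (b a.1 a.2)))ᗮ = ⊥ := by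
    -- By the spectral theorem it suffices that a vector orthogonal to the chosen bases is
    -- orthogonal to every eigenspace.
    rw [eq_bot_iff, ← ContinuousLinearMap.orthogonalComplement_iSup_eigenspaces_eq_bot hT hsym]
    intro x hx
    have hle : (⨆ μ, eigenspace (T : Module.End ℂ H) μ) ≤ (Submodule.span ℂ {x})ᗮ := by
      refine iSup_le fun μ y hy => ?_
      rw [Submodule.mem_orthogonal_singleton_iff_inner_right]
      have hs := ((b μ).hasSum_repr ⟨y, hy⟩).mapL
        ((innerSL ℂ x).comp (eigenspace (T : Module.End ℂ H) μ).subtypeL)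
      have h0 (i : w μ) : ((innerSL ℂ x).comp (eigenspace (T : Module.End ℂ H) μ).subtypeL)
          ((b μ).repr ⟨y, hy⟩ i • b μ i) = 0 := by
        have h1 : ⟪x, (b μ i : H)⟫_ℂ = 0 :=
          (Submodule.mem_orthogonal' _ x).1 hx _ (Submodule.subset_span ⟨⟨μ, i⟩, rfl⟩)
        rw [map_smul]
        change _ • ⟪x, (b μ i : H)⟫_ℂ = 0
        rw [h1, smul_zero]
      simp_rw [h0] at hs
      exact hs.unique hasSum_zero
    exact (Submodule.mem_orthogonal' _ x).2 fun y hy =>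
      Submodule.mem_orthogonal_singleton_iff_inner_right.1 (hle hy)
  refine ⟨Σ μ, w μ, HilbertBasis.mkOfOrthogonalEqBot horth hbot, fun a => a.1, fun a => ?_⟩
  rw [HilbertBasis.coe_mkOfOrthogonalEqBot]
  exact mem_eigenspace_iff.1 (b a.1 a.2).2

/-- A compact operator has singular values `s` and right singular vectors forming a basis `b`. -/
theorem exists_hilbertBasis_abs {H : Type u} [NormedAddCommGroup H]
    [InnerProductSpace ℂ H] [CompleteSpace H] {T : H →L[ℂ] H} (hT : IsCompactOperator T) :
    ∃ (ι : Type u) (b : HilbertBasis ι ℂ H) (s : ι → ℝ),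
      ∀ i, 0 ≤ s i ∧ CFC.abs T (b i) = (s i : ℂ) • b i := by
  obtain ⟨ι, b, t, ht⟩ := exists_hilbertBasis_eigenvectors (T := star T * T) (hT.clm_comp (star T))
    (ContinuousLinearMap.isSelfAdjoint_iff_isSymmetric.1 (IsSelfAdjoint.star_mul_self T))
  refine ⟨ι, b, fun i => ‖T (b i)‖, fun i => ⟨norm_nonneg _, ?_⟩⟩
  have hb : ‖b i‖ = 1 := b.orthonormal.1 i
  have htn : t i = (‖T (b i)‖ : ℂ) ^ 2 := by
    have h1 : ⟪b i, (star T * T) (b i)⟫_ℂ = (‖T (b i)‖ : ℂ) ^ 2 := by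
      rw [ContinuousLinearMap.star_eq_adjoint, mul_apply_eq_comp,
        ContinuousLinearMap.adjoint_inner_right, inner_self_eq_norm_sq_to_K]
      rfl
    rw [ht, inner_smul_right, inner_self_eq_norm_sq_to_K, hb] at h1
    simpa using h1
  set s := ‖T (b i)‖ with hs
  have hAA : CFC.abs T (CFC.abs T (b i)) = (s : ℂ) ^ 2 • b i := by
    rw [← mul_apply_eq_comp, CFC.abs_mul_abs, ht, htn]
  rcases (norm_nonneg (T (b i))).eq_or_lt with h0 | h0
  · have : CFC.abs T (b i) = 0 := by rw [← norm_eq_zero, norm_abs_apply, ← h0]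
    simp [this, ← h0]
  -- From `(|T| + s)(|T| - s) b i = 0` one gets `|T| d = -s d`; as `|T| ≥ 0` and `s > 0`, `d = 0`.
  · set d := CFC.abs T (b i) - (s : ℂ) • b i with hd
    have hAd : CFC.abs T d = -((s : ℂ) • d) := by
      rw [hd, map_sub, map_smul, hAA, smul_sub, smul_smul, pow_two]
      abel
    have hnn : 0 ≤ RCLike.re ⟪CFC.abs T d, d⟫_ℂ :=
      ((ContinuousLinearMap.nonneg_iff_isPositive _).1 (CFC.abs_nonneg T)).re_inner_nonneg_left d
    rw [hAd, inner_neg_left, inner_smul_left, map_neg, Complex.conj_ofReal] at hnn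
    have : RCLike.re ((s : ℂ) * ⟪d, d⟫_ℂ) = s * ‖d‖ ^ 2 := by
      rw [← inner_self_eq_norm_sq (𝕜 := ℂ)]
      simp
    rw [this] at hnn
    have hd0 : ‖d‖ ^ 2 = 0 := by
      have hs0 : 0 < s := h0
      nlinarith [sq_nonneg ‖d‖]
    exact sub_eq_zero.1 (norm_eq_zero.1 (pow_eq_zero_iff two_ne_zero |>.1 hd0))

theorem orthonormal_leftSingularVectors {T : H →L[ℂ] H} {ι : Type*} {b : ι → H}
    (hb : Orthonormal ℂ b) {s : ι → ℝ} (hs : ∀ i, CFC.abs T (b i) = (s i : ℂ) • b i) :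
    Orthonormal ℂ fun i : {i // s i ≠ 0} => ((s i : ℂ)⁻¹) • T (b i) := by
  classical
  rw [orthonormal_iff_ite] at hb ⊢
  rintro ⟨i, hi⟩ ⟨j, hj⟩
  rw [inner_smul_left, inner_smul_right, inner_apply_apply, hs, hs, inner_smul_left,
    inner_smul_right, hb]
  have hi' : (s i : ℂ) ≠ 0 := by exact_mod_cast hi
  by_cases h : i = j
  · subst h
    simp [hi']
  · simp [h]

/-- Both sides are the sum of the squared moduli of the matrix entries of `K`. -/
theorem posTrace_mul_star_self (K : H →L[ℂ] H) :
    posTrace (K * star K) = posTrace (star K * K) := by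
  obtain ⟨w, b, -⟩ := exists_hilbertBasis ℂ H
  have h1 := fun x => re_inner_star_mul_self (star K) x
  rw [star_star] at h1
  rw [posTrace_eq_diagSum b (mul_star_self_nonneg K), posTrace_eq_diagSum b (star_mul_self_nonneg K)]
  simp only [diagSum, h1, re_inner_star_mul_self]
  simp_rw [ofReal_norm_sq_eq_tsum b]
  rw [ENNReal.tsum_comm]
  refine tsum_congr fun j => tsum_congr fun i => ?_
  rw [ContinuousLinearMap.star_eq_adjoint, ContinuousLinearMap.adjoint_inner_right,
    norm_inner_symm]

/-- With `b` and `f` the right and left singular vectors of `K²`, each nonzero singular value is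
`⟪K* f, K b⟫ ≤ ‖K* f‖² + ‖K b‖²`, and both terms have finite sums. -/
theorem sq_mem_schattenClass_one {K : H →L[ℂ] H} (hK : K ∈ schattenClass H 2) :
    K ^ 2 ∈ schattenClass H 1 := by
  obtain ⟨hc, htr⟩ := hK
  have hc2 : IsCompactOperator ⇑(K ^ 2) := by
    rw [pow_two]
    exact hc.clm_comp K
  refine ⟨hc2, ?_⟩
  obtain ⟨ι, b, s, hs⟩ := exists_hilbertBasis_abs hc2
  have hf := orthonormal_leftSingularVectors b.orthonormal fun i => (hs i).2
  rw [pow_one, posTrace_eq_diagSum b (CFC.abs_nonneg _), diagSum]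
  have hdiag (i : ι) : RCLike.re ⟪b i, CFC.abs (K ^ 2) (b i)⟫_ℂ = s i := by
    rw [(hs i).2, inner_smul_right, inner_self_eq_norm_sq_to_K, b.orthonormal.1 i]
    simp
  simp_rw [hdiag]
  have hsupp : Function.support (fun i => ENNReal.ofReal (s i)) ⊆ {i | s i ≠ 0} := fun i hi h0 => by
    simp [h0] at hi
  rw [← tsum_subtype_eq_of_support_subset hsupp]
  have hle (i : {i // s i ≠ 0}) : ENNReal.ofReal (s i) ≤
      ENNReal.ofReal (RCLike.re ⟪((s i : ℂ)⁻¹) • (K ^ 2) (b i),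
        (K * star K) (((s i : ℂ)⁻¹) • (K ^ 2) (b i))⟫_ℂ) +
      ENNReal.ofReal (RCLike.re ⟪b i, (CFC.abs K ^ 2) (b i)⟫_ℂ) := by
    have hi' : (s i : ℂ) ≠ 0 := by exact_mod_cast i.2
    set f := ((s i : ℂ)⁻¹) • (K ^ 2) (b i) with hfdef
    have h1 := re_inner_star_mul_self (star K) f
    rw [star_star] at h1
    rw [h1, re_inner_abs_pow_two, ← ENNReal.ofReal_add (by positivity) (by positivity)]
    refine ENNReal.ofReal_le_ofReal ?_
    have h2 : (s i : ℝ) = RCLike.re ⟪(star K) f, K (b i)⟫_ℂ := by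
      rw [ContinuousLinearMap.star_eq_adjoint, ContinuousLinearMap.adjoint_inner_left]
      change _ = RCLike.re ⟪f, (K ^ 2) (b i)⟫_ℂ
      rw [hfdef, inner_smul_left, inner_apply_apply, (hs i).2, inner_smul_left, inner_smul_right,
        inner_self_eq_norm_sq_to_K, b.orthonormal.1 i]
      simp [hi']
    have h3 := re_inner_le_norm (𝕜 := ℂ) ((star K) f) (K (b i))
    nlinarith [sq_nonneg (‖(star K) f‖ - ‖K (b i)‖), sq_nonneg ‖(star K) f‖, sq_nonneg ‖K (b i)‖]
  refine lt_of_le_of_lt (ENNReal.tsum_le_tsum hle) ?_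
  rw [ENNReal.tsum_add, ENNReal.add_lt_top]
  constructor
  · refine (tsum_ofReal_inner_le_posTrace hf (mul_star_self_nonneg K)).trans_lt ?_
    rwa [posTrace_mul_star_self, ← abs_pow_two]
  · exact (tsum_ofReal_inner_le_posTrace (b.orthonormal.comp _ Subtype.val_injective)
      (CStarAlgebra.pow_nonneg (CFC.abs_nonneg K) 2)).trans_lt htr

/-- Here `b` and `f` are singular vectors of `K` itself, so `K² b = s K f`. With `t = ‖K f‖`, `(s
t)² ≤ max(s, t)⁴ ≤ ‖K‖ (s³ + t³)`, and the cubes are summable by `norm_apply_pow_three_le`. -/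
theorem sq_mem_schattenClass_two {K : H →L[ℂ] H} (hK : K ∈ schattenClass H 3) :
    K ^ 2 ∈ schattenClass H 2 := by
  obtain ⟨hc, htr⟩ := hK
  have hc2 : IsCompactOperator ⇑(K ^ 2) := by
    rw [pow_two]
    exact hc.clm_comp K
  refine ⟨hc2, ?_⟩
  obtain ⟨ι, b, s, hs⟩ := exists_hilbertBasis_abs hc
  have hf := orthonormal_leftSingularVectors b.orthonormal fun i => (hs i).2
  rw [posTrace_eq_diagSum b (CStarAlgebra.pow_nonneg (CFC.abs_nonneg _) 2), diagSum]
  simp_rw [re_inner_abs_pow_two]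
  have hKb (i : ι) : ‖K (b i)‖ = s i := by
    rw [← norm_abs_apply, (hs i).2, norm_smul, b.orthonormal.1 i, mul_one, Complex.norm_real,
      Real.norm_of_nonneg (hs i).1]
  have hsupp : Function.support (fun i => ENNReal.ofReal (‖(K ^ 2) (b i)‖ ^ 2)) ⊆
      {i | s i ≠ 0} := fun i hi h0 => by
    have h1 : K (b i) = 0 := by rw [← norm_eq_zero, hKb, h0]
    have h2 : K (K (b i)) = 0 := by rw [h1, map_zero]
    simp [h2] at hi
  rw [← tsum_subtype_eq_of_support_subset hsupp]
  have hle (i : {i // s i ≠ 0}) : ENNReal.ofReal (‖(K ^ 2) (b i)‖ ^ 2) ≤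
      ENNReal.ofReal ‖K‖ * (ENNReal.ofReal (RCLike.re ⟪b i, (CFC.abs K ^ 3) (b i)⟫_ℂ) +
        ENNReal.ofReal (RCLike.re ⟪((s i : ℂ)⁻¹) • K (b i),
          (CFC.abs K ^ 3) (((s i : ℂ)⁻¹) • K (b i))⟫_ℂ)) := by
    have hi' : (s i : ℂ) ≠ 0 := by exact_mod_cast i.2
    have hf1 := hf.1 i
    have hfi := norm_apply_pow_three_le K hf1
    have hbi := norm_apply_pow_three_le K (b.orthonormal.1 i)
    rw [hKb] at hbi
    have hKf : (K ^ 2) (b i) = (s i : ℂ) • K (((s i : ℂ)⁻¹) • K (b i)) := by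
      rw [map_smul, smul_inv_smul₀ hi']
      rfl
    set f := ((s i : ℂ)⁻¹) • K (b i) with hfdef
    have hs0 : 0 ≤ s i := (hs i).1
    have hsK : s i ≤ ‖K‖ := by
      rw [← hKb]
      simpa [b.orthonormal.1 i] using K.le_opNorm (b i)
    have htK : ‖K f‖ ≤ ‖K‖ := (K.le_opNorm f).trans_eq (by rw [show ‖f‖ = 1 from hf1, mul_one])
    rw [hKf, norm_smul, Complex.norm_real, Real.norm_of_nonneg hs0,
      ← ENNReal.ofReal_add ((pow_nonneg hs0 3).trans hbi) (le_trans (by positivity) hfi),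
      ← ENNReal.ofReal_mul (norm_nonneg K)]
    refine ENNReal.ofReal_le_ofReal (le_trans ?_
      (mul_le_mul_of_nonneg_left (add_le_add hbi hfi) (norm_nonneg K)))
    rcases le_total (s i) ‖K f‖ with h | h
    · calc (s i * ‖K f‖) ^ 2 ≤ (‖K f‖ * ‖K f‖) ^ 2 := by gcongr
        _ = ‖K f‖ * ‖K f‖ ^ 3 := by ring
        _ ≤ ‖K‖ * (s i ^ 3 + ‖K f‖ ^ 3) := by
          gcongr
          exact le_add_of_nonneg_left (by positivity)
    · calc (s i * ‖K f‖) ^ 2 ≤ (s i * s i) ^ 2 := by gcongr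
        _ = s i * s i ^ 3 := by ring
        _ ≤ ‖K‖ * (s i ^ 3 + ‖K f‖ ^ 3) := by
          gcongr
          exact le_add_of_nonneg_right (by positivity)
  have hpos := CStarAlgebra.pow_nonneg (CFC.abs_nonneg K) 3
  refine lt_of_le_of_lt (ENNReal.tsum_le_tsum hle) ?_
  rw [ENNReal.tsum_mul_left, ENNReal.tsum_add]
  refine ENNReal.mul_lt_top ENNReal.ofReal_lt_top (ENNReal.add_lt_top.2 ⟨?_, ?_⟩)
  · exact (tsum_ofReal_inner_le_posTrace (b.orthonormal.comp _ Subtype.val_injective)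
      hpos).trans_lt htr
  · exact (tsum_ofReal_inner_le_posTrace hf hpos).trans_lt htr

end Schatten

end FredholmDet

theorem mainTheorem4 {H : Type*} [NormedAddCommGroup H] [InnerProductSpace ℂ H] [CompleteSpace H]
    [TopologicalSpace.SeparableSpace H] (K : H →L[ℂ] H) :
    (K ∈ FredholmDet.schattenClass H 2 →
      K ^ 2 ∈ FredholmDet.schattenClass H 1 ∧
      ∀ z : ℂ,
        (FredholmDet.DetConverges 1 (K ^ 2) (-z ^ 2) ∧
          FredholmDet.DetConverges 2 K (-z) ∧ FredholmDet.DetConverges 2 K z) ∧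
        FredholmDet.modDet 1 (K ^ 2) (-z ^ 2) =
          FredholmDet.modDet 2 K (-z) * FredholmDet.modDet 2 K z ∧
        (FredholmDet.modDet 2 K (-z) = FredholmDet.modDet 2 K z →
          FredholmDet.modDet 2 K (-z) ^ 2 = FredholmDet.modDet 1 (K ^ 2) (-z ^ 2))) ∧
    (K ∈ FredholmDet.schattenClass H 3 →
      K ^ 2 ∈ FredholmDet.schattenClass H 2 ∧
      ∀ z : ℂ,
        (FredholmDet.DetConverges 2 (K ^ 2) (-z ^ 2) ∧
          FredholmDet.DetConverges 3 K (-z) ∧ FredholmDet.DetConverges 3 K z) ∧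
        FredholmDet.modDet 2 (K ^ 2) (-z ^ 2) =
          FredholmDet.modDet 3 K (-z) * FredholmDet.modDet 3 K z) := by
  open FredholmDet in
  refine ⟨fun hK => ⟨sq_mem_schattenClass_one hK, fun z => ?_⟩,
    fun hK => ⟨sq_mem_schattenClass_two hK, fun z => ?_⟩⟩
  · have hC := sum_norm_inner_pow_le (fun x _ => (re_inner_abs_pow_two K x).ge) hK.2
    have hconv := detConverges_of_summable one_le_two (summable_algMult_mul_of_forall_orthonormal hC)
    have hprod := hasProd_detFactor_sq (q := 1)
      (fun ν hν => finiteDimensional_maxGenEigenspace_of_forall_orthonormal hC hν)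
      (hconv (-z)) (hconv z) fun μ => by
        rw [mul_mul_mul_comm, ← Complex.exp_add]
        simp [show Finset.Ico 1 2 = {1} from rfl]
        ring
    refine ⟨⟨hprod.multipliable, hconv _, hconv _⟩, hprod.tprod_eq, fun h => ?_⟩
    refine Eq.trans ?_ hprod.tprod_eq.symm
    rw [← h, pow_two]
  · have hC := sum_norm_inner_pow_le (fun x hx => norm_apply_pow_three_le K hx) hK.2
    have hconv := detConverges_of_summable (by norm_num)
      (summable_algMult_mul_of_forall_orthonormal hC)
    have hprod := hasProd_detFactor_sq (q := 2)
      (fun ν hν => finiteDimensional_maxGenEigenspace_of_forall_orthonormal hC hν)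
      -- The linear terms cancel, and twice `z²μ²/2` is the exponent `(-z²)(-μ²)` for `K²`.
      (hconv (-z)) (hconv z) fun μ => by
        rw [mul_mul_mul_comm, ← Complex.exp_add]
        congr 1
        · ring
        · congr 1
          simp [Finset.sum_Ico_succ_top]
          ring
    exact ⟨⟨hprod.multipliable, hconv _, hconv _⟩, hprod.tprod_eq⟩
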